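/- \textbf{Theorem.} Let $k\ge 1$ be an integer. An $r$-uniform hypergraph ($r$-graph) is a collection of $r$-element subsets (edges) of a vertex set. For an $r$-graph $F$, let $\mathrm{ex}(n,F)$ be the maximum number of edges of an $r$-graph on $n$ vertices that does not contain $F$ as a subgraph, and let $$\pi(F)=\lim_{n\to\infty}\frac{\mathrm{ex}(n,F)}{\binom{n}{r}}$$ be the Tur\'an density of $F$. Let $S_1,S_2,S_3$ be pairwise disjoint $k$-sets and let $$\mathbb{T}_{2k}=\{S_1\cup S_2,\ S_2\cup S_3,\ S_3\cup S_1\}$$ be the expanded triangle, a $2k$-graph on $S_1\cup S_2\cup S_3$. Let $\hat{\mathbb{T}}_{2k}^{2k+1}=\{\{v\}\cup e : e\in\mathbb{T}_{2k}\}$ be its $(2k+1)$-uniform suspension, where $v\notin S_1\cup S_2\cup S_3$ is a new vertex. Then $$\pi\big(\hat{\mathbb{T}}_{2k}^{2k+1}\big)<\frac12 .$$ -/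

import Mathlib

/-- An `r`-uniform hypergraph (`r`-graph) with vertex set `V`: a (finite) collection of
`r`-element subsets of `V`. -/
@[ext]
structure UniformHypergraph (V : Type*) (r : ℕ) where
  /-- The set of edges. -/
  edges : Finset (Finset V)
  /-- Every edge has exactly `r` vertices. -/
  sized : (edges : Set (Finset V)).Sized r

namespace UniformHypergraph

/-- `F` is contained in `H` as a (not necessarily induced) subgraph: some injection of the
vertices of `F` into those of `H` maps every edge of `F` to an edge of `H`. -/
def IsContained {V W : Type*} {r : ℕ} (F : UniformHypergraph V r)
    (H : UniformHypergraph W r) : Prop :=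
  ∃ φ : V ↪ W, ∀ e ∈ F.edges, e.map φ ∈ H.edges

/-- `H` is `F`-free. -/
def IsFree {V W : Type*} {r : ℕ} (F : UniformHypergraph V r)
    (H : UniformHypergraph W r) : Prop :=
  ¬ F.IsContained H

/-- The numbers of edges of the `F`-free `r`-graphs on `n` vertices. -/
def freeSizes {V : Type*} {r : ℕ} (n : ℕ) (F : UniformHypergraph V r) : Set ℕ :=
  {m | ∃ H : UniformHypergraph (Fin n) r, F.IsFree H ∧ H.edges.card = m}

/-- The Turán number `ex(n, F)`: the maximum number of edges of an `F`-free `r`-graph on `n`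
vertices. -/
noncomputable def turanNumber {V : Type*} {r : ℕ} (n : ℕ) (F : UniformHypergraph V r) : ℕ :=
  sSup (freeSizes n F)

/-- The Turán density `π(F) = lim_{n → ∞} ex(n, F) / (n choose r)`. The limit always exists:
see `tendsto_turanDensity`. -/
noncomputable def turanDensity {V : Type*} {r : ℕ} (F : UniformHypergraph V r) : ℝ :=
  Filter.atTop.limUnder fun n : ℕ => (turanNumber n F : ℝ) / (n.choose r : ℝ)

theorem disjSum_univ_injective (V : Type*) (m : ℕ) :
    Function.Injective fun e : Finset V => e.disjSum (Finset.univ : Finset (Fin m)) := by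
  intro a b h
  ext x
  have := congrArg (fun t => Sum.inl x ∈ t) h
  simpa using this

/-- The `r`-suspension of an `s`-graph `F` (`s ≤ r`): its edges are the sets `C ∪ e` with
`e ∈ F`, where `C` is a set of `r - s` new vertices. Here the vertex set is the disjoint union
`V ⊕ Fin (r - s)`, and `C` is its second summand. -/
def suspension {V : Type*} {s : ℕ} (F : UniformHypergraph V s) (r : ℕ) (hr : s ≤ r) :
    UniformHypergraph (V ⊕ Fin (r - s)) r where
  edges := F.edges.map
    ⟨fun e => e.disjSum (Finset.univ : Finset (Fin (r - s))), disjSum_univ_injective V (r - s)⟩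
  sized := by
    intro e he
    obtain ⟨e', he', rfl⟩ := Finset.mem_map.mp (Finset.mem_coe.mp he)
    have := F.sized he'
    simp only [Function.Embedding.coeFn_mk, Finset.card_disjSum, Finset.card_univ,
      Fintype.card_fin]
    omega

/-- The expanded triangle `T_{2k} = {S₁ ∪ S₂, S₂ ∪ S₃, S₃ ∪ S₁}`, where the disjoint `k`-sets
are the three rows `{i} × Fin k` of `Fin 3 × Fin k`. -/
def expandedTriangle (k : ℕ) : UniformHypergraph (Fin 3 × Fin k) (2 * k) where
  edges :=
    let S : Fin 3 → Finset (Fin 3 × Fin k) := fun i => {i} ×ˢ Finset.univ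
    {S 0 ∪ S 1, S 1 ∪ S 2, S 2 ∪ S 0}
  sized := by
    have key : ∀ i j : Fin 3, i ≠ j →
        (({i} ×ˢ Finset.univ ∪ {j} ×ˢ Finset.univ : Finset (Fin 3 × Fin k))).card = 2 * k := by
      intro i j hij
      rw [Finset.card_union_of_disjoint]
      · simp; omega
      · rw [Finset.disjoint_left]
        rintro ⟨a, b⟩ ha hb
        simp only [Finset.mem_product, Finset.mem_singleton, Finset.mem_univ, and_true] at ha hb
        exact hij (ha.symm.trans hb)
    intro e he
    simp only [Finset.coe_insert, Finset.coe_singleton, Set.mem_insert_iff,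
      Set.mem_singleton_iff] at he
    rcases he with rfl | rfl | rfl
    · exact key 0 1 (by decide)
    · exact key 1 2 (by decide)
    · exact key 2 0 (by decide)

theorem bddAbove_freeSizes {V : Type*} {r : ℕ} (n : ℕ) (F : UniformHypergraph V r) :
    BddAbove (freeSizes n F) := by
  refine ⟨Fintype.card (Finset (Fin n)), ?_⟩
  rintro m ⟨H, -, rfl⟩
  exact Finset.card_le_univ _

/-- Deleting one vertex at a time and averaging. -/
theorem mul_turanNumber_succ_le {V : Type*} {r : ℕ} (n : ℕ) (F : UniformHypergraph V r) :
    turanNumber (n + 1) F * (n + 1 - r) ≤ (n + 1) * turanNumber n F := by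
  classical
  by_cases hne : (freeSizes (n + 1) F).Nonempty
  swap
  · rw [Set.not_nonempty_iff_eq_empty] at hne
    simp [turanNumber, hne]
  obtain ⟨H, hH, hm⟩ := Nat.sSup_mem hne (bddAbove_freeSizes (n + 1) F)
  have hm' : H.edges.card = turanNumber (n + 1) F := hm
  have hv : ∀ v : Fin (n + 1), (H.edges.filter fun e => v ∉ e).card ≤ turanNumber n F := by
    intro v
    let g : Finset (Fin n) → Finset (Fin (n + 1)) := Finset.map v.succAboveEmb
    let D : UniformHypergraph (Fin n) r :=
      { edges := Finset.univ.filter fun e => g e ∈ H.edges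
        sized := by
          intro e he
          have he' : g e ∈ H.edges := by simpa using he
          simpa [g] using H.sized he' }
    have hD : F.IsFree D := by
      rintro ⟨φ, hφ⟩
      refine hH ⟨φ.trans v.succAboveEmb, fun e he => ?_⟩
      have := hφ e he
      simp only [D, g, Finset.mem_filter, Finset.mem_univ, true_and, Finset.map_map] at this
      exact this
    have hcard : (H.edges.filter fun e => v ∉ e) = D.edges.map (Finset.mapEmbedding v.succAboveEmb).toEmbedding := by
      ext e
      simp only [Finset.mem_filter, Finset.mem_map, D, g, Finset.mem_univ, true_and]
      constructor
      · rintro ⟨he, hve⟩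
        have hsub : e ⊆ (Finset.univ : Finset (Fin n)).map v.succAboveEmb := by
          intro x hx
          have hxv : x ≠ v := fun h => hve (h ▸ hx)
          obtain ⟨y, hy⟩ := Fin.exists_succAbove_eq hxv
          simp only [Finset.mem_map, Finset.mem_univ, true_and]
          exact ⟨y, hy⟩
        obtain ⟨u, -, hu⟩ := Finset.subset_map_iff.mp hsub
        exact ⟨u, hu ▸ he, hu.symm⟩
      · rintro ⟨u, hu, rfl⟩
        refine ⟨hu, ?_⟩
        change v ∉ u.map v.succAboveEmb
        simp [Fin.succAbove_ne]
    rw [hcard, Finset.card_map]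
    exact le_csSup (bddAbove_freeSizes n F) ⟨D, hD, rfl⟩
  have hdc := Finset.sum_card_bipartiteAbove_eq_sum_card_bipartiteBelow
    (s := (Finset.univ : Finset (Fin (n + 1)))) (t := H.edges) (fun v e => v ∉ e)
  have hL : ∑ v : Fin (n + 1), (H.edges.bipartiteAbove (fun v e => v ∉ e) v).card
      ≤ (n + 1) * turanNumber n F := by
    refine (Finset.sum_le_card_nsmul _ _ _ fun v _ => hv v).trans ?_
    simp
  have hR : ∑ e ∈ H.edges, ((Finset.univ : Finset (Fin (n + 1))).bipartiteBelow
      (fun v e => v ∉ e) e).card = H.edges.card * (n + 1 - r) := by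
    refine Finset.sum_const_nat fun e he => ?_
    have h1 : (Finset.univ : Finset (Fin (n + 1))).bipartiteBelow (fun v e => v ∉ e) e = eᶜ := by
      ext x
      simp [Finset.bipartiteBelow]
    rw [h1, Finset.card_compl, H.sized he, Fintype.card_fin]
  rw [← hm', ← hR, ← hdc]
  exact hL

/-- The limit in the definition of the Turán density exists. -/
theorem tendsto_turanDensity {V : Type*} {r : ℕ} (F : UniformHypergraph V r) :
    Filter.Tendsto (fun n : ℕ => (turanNumber n F : ℝ) / (n.choose r : ℝ)) Filter.atTop
      (nhds (turanDensity F)) := by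
  have hanti : AntitoneOn (fun n : ℕ => (turanNumber n F : ℝ) / (n.choose r : ℝ))
      (Set.Ici r) := by
    apply antitoneOn_nat_Ici_of_succ_le
    intro n hn
    have h1 : (0 : ℝ) < n.choose r := by exact_mod_cast Nat.choose_pos hn
    have h2 : (0 : ℝ) < (n + 1).choose r := by exact_mod_cast Nat.choose_pos (by omega)
    rw [div_le_div_iff₀ h2 h1]
    have hpos : 0 < n + 1 - r := by omega
    have h3 := mul_turanNumber_succ_le n F
    have h4 := Nat.choose_mul_succ_eq n r
    have : turanNumber (n + 1) F * n.choose r ≤ turanNumber n F * (n + 1).choose r := by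
      refine Nat.le_of_mul_le_mul_left ?_ hpos
      calc (n + 1 - r) * (turanNumber (n + 1) F * n.choose r)
          = (turanNumber (n + 1) F * (n + 1 - r)) * n.choose r := by ring
        _ ≤ ((n + 1) * turanNumber n F) * n.choose r := Nat.mul_le_mul_right _ h3
        _ = turanNumber n F * (n.choose r * (n + 1)) := by ring
        _ = (n + 1 - r) * (turanNumber n F * (n + 1).choose r) := by rw [h4]; ring
    exact_mod_cast this
  have hbdd : BddBelow ((fun n : ℕ => (turanNumber n F : ℝ) / (n.choose r : ℝ)) ''
      Set.Ici r) := by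
    refine ⟨0, ?_⟩
    rintro x ⟨n, -, rfl⟩
    positivity
  have h := Real.tendsto_atTop_csInf_of_antitoneOn_bddBelow_nat_Ici hanti hbdd
  exact tendsto_nhds_limUnder ⟨_, h⟩

end UniformHypergraph

/-!
Write `F` for the suspended triangle and let `H` be an `F`-free `(2k+1)`-graph. Fix a vertex `v`
and disjoint `k`-sets `S₁, …, S_m`, and join two of the `S_i` when their union with `v` is an edge
of `H`. This graph is triangle-free, and Goodman's double count shows that if its density is close
to `1/2` then almost every triple `S_i, S_j, S_l` spans an even number of its edges
(`sum_oddTriple_le`). Averaging over all permutations of the vertex set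
(`mul_card_filter_triangleParity_le`): if `H` has density `1/2 - o(1)`, then its indicator
`f : Finset V → ZMod 2` satisfies
`f (v S₁ S₂) + f (v S₂ S₃) + f (v S₃ S₁) = 0` for all but an `O(1/m)` proportion of the
choices of `v, S₁, S₂, S₃`.

On the other hand, these relations are rigid: on any set of at least `3k + 2` vertices, a function
satisfying all of them vanishes on every `(2k+1)`-set (`eq_zero_of_triangle_relation`). Indeed, put
`D(T) = f (x T) + f (y T)`. For `v ∈ A`, the relations with apex `v` and triples
`(A - v + x, B, C)`, `(A - v + y, B, C)` give `D(A ∪ B) = D(A ∪ C)`, hence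
`D(A ∪ B) = D(B ∪ C) = D(C ∪ A)`. The relations with apexes `x` and `y` and triple `(A, B, C)` say
that these three equal values add up to `0`, so `D = 0`. Thus `f` is constant on `(2k+1)`-sets, and
then any relation reads `3 f = 0`.

So every edge of `H` inside a window of `3k + 2` vertices forces one of boundedly many relations in
that window to fail. A union bound (`card_filter_mem_le`) bounds the density of `H` by a constant
times the proportion of failing relations. For a fixed large `m` the two bounds together keep the
density of `H` below a constant less than `1/2`, uniformly in the number of vertices
(`UniformHypergraph.IsFree.card_edges_mul_le`).
-/

open Finset

/-! ### Rigidity of the triangle relations over `ZMod 2` -/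

/-- The effect on `f` of replacing `x` by `y` in `insert x (A ∪ B)` does not change when `B` is
replaced by `C`: for `v ∈ A`, add the relations with apex `v` and triples `(A - v + x, B, C)` and
`(A - v + y, B, C)`. -/
theorem apply_insert_add_apply_insert_eq {W : Type*} [DecidableEq W] {k : ℕ} (hk : 1 ≤ k)
    {f : Finset W → ZMod 2}
    (h : ∀ (v : W) (S : Fin 3 → Finset W), (∀ i, #(S i) = k) → (∀ i, v ∉ S i) →
      (∀ i j, i ≠ j → Disjoint (S i) (S j)) →
      f (insert v (S 0 ∪ S 1)) + f (insert v (S 1 ∪ S 2)) + f (insert v (S 2 ∪ S 0)) = 0)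
    {A B C : Finset W} {x y : W} (hA : #A = k) (hB : #B = k) (hC : #C = k)
    (hAB : Disjoint A B) (hBC : Disjoint B C) (hAC : Disjoint A C)
    (hx : x ∉ A ∪ B ∪ C) (hy : y ∉ A ∪ B ∪ C) :
    f (insert x (A ∪ B)) + f (insert y (A ∪ B)) =
      f (insert x (A ∪ C)) + f (insert y (A ∪ C)) := by
  obtain ⟨v, hv⟩ : A.Nonempty := card_pos.mp (by omega)
  have hvB : v ∉ B := disjoint_left.mp hAB hv
  have hvC : v ∉ C := disjoint_left.mp hAC hv
  have rel : ∀ z, z ∉ A ∪ B ∪ C →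
      f (insert z (A ∪ B)) + f (insert v (B ∪ C)) + f (insert z (A ∪ C)) = 0 := by
    intro z hz
    simp only [mem_union, not_or] at hz
    have hzA : z ∉ A.erase v := fun hh => hz.1.1 (mem_of_mem_erase hh)
    have hzv : v ≠ z := fun hh => hz.1.1 (hh ▸ hv)
    have dB : Disjoint (insert z (A.erase v)) B :=
      disjoint_insert_left.mpr ⟨hz.1.2, hAB.mono_left (erase_subset _ _)⟩
    have dC : Disjoint (insert z (A.erase v)) C :=
      disjoint_insert_left.mpr ⟨hz.2, hAC.mono_left (erase_subset _ _)⟩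
    have := h v ![insert z (A.erase v), B, C] ?_ ?_ ?_
    · simp only [Matrix.cons_val_zero, Matrix.cons_val_one, Matrix.cons_val] at this
      have e : ∀ D, insert v (insert z (A.erase v) ∪ D) = insert z (A ∪ D) := by
        intro D
        rw [insert_union, insert_comm, ← insert_union, insert_erase hv]
      rw [union_comm C, e, e] at this
      exact this
    · have : #(insert z (A.erase v)) = k := by
        rw [card_insert_of_notMem hzA, card_erase_of_mem hv]; omega
      intro i; fin_cases i <;> simpa
    · intro i; fin_cases i <;> simp [hzv, hvB, hvC]
    · intro i j hij
      fin_cases i <;> fin_cases j <;> first | exact absurd rfl hij | skip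
      exacts [dB, dC, dB.symm, hBC, dC.symm, hBC.symm]
  have h2 : (2 : ZMod 2) = 0 := rfl
  have hx' := rel x hx
  have hy' := rel y hy
  linear_combination hx' + hy' - (f (insert x (A ∪ C)) + f (insert y (A ∪ C)) +
    f (insert v (B ∪ C))) * h2

/-- A function satisfying all triangle relations does not change when one vertex of a
`(2 * k + 1)`-set is replaced by another. -/
theorem apply_insert_eq_apply_insert {W : Type*} [DecidableEq W] [Fintype W] {k : ℕ} (hk : 1 ≤ k)
    (hW : 3 * k + 2 ≤ Fintype.card W) {f : Finset W → ZMod 2}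
    (h : ∀ (v : W) (S : Fin 3 → Finset W), (∀ i, #(S i) = k) → (∀ i, v ∉ S i) →
      (∀ i j, i ≠ j → Disjoint (S i) (S j)) →
      f (insert v (S 0 ∪ S 1)) + f (insert v (S 1 ∪ S 2)) + f (insert v (S 2 ∪ S 0)) = 0)
    {T : Finset W} (hT : #T = 2 * k) {x y : W} (hx : x ∉ T) (hy : y ∉ T) :
    f (insert x T) = f (insert y T) := by
  obtain ⟨A, hAT, hA⟩ := exists_subset_card_eq (s := T) (n := k) (by omega)
  obtain ⟨C, hCsub, hC⟩ := exists_subset_card_eq (s := (insert x (insert y T))ᶜ) (n := k) (by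
    have h1 := card_insert_le x (insert y T)
    have h2 := card_insert_le y T
    rw [card_compl]; omega)
  have hCd : Disjoint (insert x (insert y T)) C := by
    rw [disjoint_left]; intro a ha hc; exact (mem_compl.mp (hCsub hc)) ha
  simp only [disjoint_insert_left] at hCd
  obtain ⟨hxC, hyC, hTC⟩ := hCd
  set B := T \ A
  have hB : #B = k := by rw [card_sdiff_of_subset hAT]; omega
  have hABT : A ∪ B = T := union_sdiff_of_subset hAT
  have hAB : Disjoint A B := disjoint_sdiff
  have hAC : Disjoint A C := hTC.mono_left hAT
  have hBC : Disjoint B C := hTC.mono_left sdiff_subset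
  have out : ∀ z, z ∉ T → z ∉ C → z ∉ A ∪ B ∪ C ∧ z ∉ B ∪ A ∪ C ∧
      f (insert z (A ∪ B)) + f (insert z (B ∪ C)) + f (insert z (C ∪ A)) = 0 := by
    intro z hzT hzC
    have h1 : z ∉ A ∪ B ∪ C := by rw [hABT]; simp [hzT, hzC]
    refine ⟨h1, by rwa [union_comm B A], ?_⟩
    refine h z ![A, B, C] ?_ ?_ ?_
    · intro i; fin_cases i <;> simpa
    · simp only [mem_union, not_or] at h1
      intro i; fin_cases i <;> simp [h1]
    · intro i j hij
      fin_cases i <;> fin_cases j <;> first | exact absurd rfl hij | skip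
      exacts [hAB, hAC, hAB.symm, hBC, hAC.symm, hBC.symm]
  obtain ⟨hx1, hx2, hx3⟩ := out x hx hxC
  obtain ⟨hy1, hy2, hy3⟩ := out y hy hyC
  have k1 := apply_insert_add_apply_insert_eq hk h hA hB hC hAB hBC hAC hx1 hy1
  have k2 := apply_insert_add_apply_insert_eq hk h hB hA hC hAB.symm hAC hBC hx2 hy2
  rw [union_comm B A] at k2
  rw [union_comm C A] at hx3 hy3
  rw [← hABT]
  have h2 : (2 : ZMod 2) = 0 := rfl
  linear_combination hx3 + hy3 + k1 + k2 - (f (insert x (A ∪ B)) + 2 * f (insert y (A ∪ B))) * h2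

/-- A function satisfying all triangle relations on at least `3 * k + 2` vertices vanishes on all
`(2 * k + 1)`-sets. -/
theorem eq_zero_of_triangle_relation {W : Type*} [DecidableEq W] [Fintype W] {k : ℕ} (hk : 1 ≤ k)
    (hW : 3 * k + 2 ≤ Fintype.card W) {f : Finset W → ZMod 2}
    (h : ∀ (v : W) (S : Fin 3 → Finset W), (∀ i, #(S i) = k) → (∀ i, v ∉ S i) →
      (∀ i j, i ≠ j → Disjoint (S i) (S j)) →
      f (insert v (S 0 ∪ S 1)) + f (insert v (S 1 ∪ S 2)) + f (insert v (S 2 ∪ S 0)) = 0)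
    {E : Finset W} (hE : #E = 2 * k + 1) : f E = 0 := by
  -- any two `(2 * k + 1)`-sets are connected by exchanges of single vertices
  have const : ∀ d, ∀ E E' : Finset W, #E = 2 * k + 1 → #E' = 2 * k + 1 → #(E \ E') = d →
      f E = f E' := by
    intro d
    induction d with
    | zero =>
      intro E E' hE hE' hd
      rw [eq_of_subset_of_card_le (sdiff_eq_empty_iff_subset.mp (card_eq_zero.mp hd)) (by omega)]
    | succ d ih =>
      intro E E' hE hE' hd
      obtain ⟨x, hx⟩ : (E \ E').Nonempty := card_pos.mp (by omega)
      obtain ⟨y, hy⟩ : (E' \ E).Nonempty := by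
        rw [← card_pos]
        have := card_sdiff_comm (hE.trans hE'.symm)
        omega
      rw [mem_sdiff] at hx hy
      have hT : #(E.erase x) = 2 * k := by rw [card_erase_of_mem hx.1]; omega
      have hyT : y ∉ E.erase x := fun hh => hy.2 (mem_of_mem_erase hh)
      have hs := apply_insert_eq_apply_insert hk hW h hT (notMem_erase x E) hyT
      rw [insert_erase hx.1] at hs
      rw [hs]
      refine ih _ _ (by rw [card_insert_of_notMem hyT, hT]) hE' ?_
      rw [insert_sdiff_of_mem _ hy.1, erase_sdiff_comm, card_erase_of_mem (mem_sdiff.mpr hx), hd]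
      rfl
  obtain ⟨v, hv⟩ : E.Nonempty := card_pos.mp (by omega)
  have hT : #(E.erase v) = 2 * k := by rw [card_erase_of_mem hv]; omega
  obtain ⟨A, hAT, hA⟩ := exists_subset_card_eq (s := E.erase v) (n := k) (by omega)
  obtain ⟨C, hCsub, hC⟩ := exists_subset_card_eq (s := Eᶜ) (n := k) (by
    rw [card_compl]; omega)
  have hEC : Disjoint E C := by
    rw [disjoint_left]; intro a ha hc; exact (mem_compl.mp (hCsub hc)) ha
  have hB : #(E.erase v \ A) = k := by rw [card_sdiff_of_subset hAT]; omega
  have hAB : Disjoint A (E.erase v \ A) := disjoint_sdiff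
  have hAC : Disjoint A C := hEC.mono_left (hAT.trans (erase_subset _ _))
  have hBC : Disjoint (E.erase v \ A) C :=
    hEC.mono_left (sdiff_subset.trans (erase_subset _ _))
  have hvA : v ∉ A := fun hh => notMem_erase v E (hAT hh)
  have hvB : v ∉ E.erase v \ A := fun hh => notMem_erase v E (mem_sdiff.mp hh).1
  have hvC : v ∉ C := disjoint_left.mp hEC hv
  have c : ∀ {S T : Finset W}, #S = k → #T = k → v ∉ S → v ∉ T → Disjoint S T →
      f (insert v (S ∪ T)) = f E := by
    intro S T hS hT hvS hvT hd
    refine const _ _ _ ?_ hE rfl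
    rw [card_insert_of_notMem (by simp [hvS, hvT]), card_union_of_disjoint hd]; omega
  have := h v ![A, E.erase v \ A, C] ?_ ?_ ?_
  · simp only [Matrix.cons_val_zero, Matrix.cons_val_one, Matrix.cons_val] at this
    rw [c hA hB hvA hvB hAB, c hB hC hvB hvC hBC, c hC hA hvC hvA hAC.symm] at this
    -- all three terms of one relation equal `f E`, so `3 * f E = 0`
    have h2 : (2 : ZMod 2) = 0 := rfl
    linear_combination this - f E * h2
  · intro i; fin_cases i <;> simpa
  · intro i; fin_cases i <;> first | exact hvA | exact hvB | exact hvC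
  · intro i j hij
    fin_cases i <;> fin_cases j <;> first | exact absurd rfl hij | skip
    exacts [hAB, hAC, hAB.symm, hBC, hAC.symm, hBC.symm]

/-! ### Apexes and blocks -/

/-- Think of `Option (ι × Fin k)` as an apex `none` together with disjoint blocks of size `k`
indexed by `ι`. The set `apexEdge k i j` consists of the apex and the blocks `i` and `j`. The
three sets `apexEdge k i j` with `i ≠ j` in `Fin 3` are the edges of the suspended expanded
triangle. -/
def apexEdge {ι : Type*} [DecidableEq ι] (k : ℕ) (i j : ι) : Finset (Option (ι × Fin k)) :=
  insertNone (({i, j} : Finset ι) ×ˢ univ)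

theorem card_apexEdge {ι : Type*} [DecidableEq ι] (k : ℕ) {i j : ι} (h : i ≠ j) :
    #(apexEdge k i j) = 2 * k + 1 := by
  simp [apexEdge, card_insertNone, card_product, card_pair h]

theorem apexEdge_comm {ι : Type*} [DecidableEq ι] (k : ℕ) (i j : ι) :
    apexEdge k i j = apexEdge k j i := by
  rw [apexEdge, pair_comm, apexEdge]

/-- The injection of block systems that fixes the apex and moves block `i` onto block `g i`. -/
def blockMap {ι κ : Type*} (k : ℕ) (g : ι ↪ κ) : Option (ι × Fin k) ↪ Option (κ × Fin k) :=
  (g.prodMap (Function.Embedding.refl (Fin k))).optionMap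

theorem map_blockMap_apexEdge {ι κ : Type*} [DecidableEq ι] [DecidableEq κ] (k : ℕ) (g : ι ↪ κ)
    (i j : ι) : (apexEdge k i j).map (blockMap k g) = apexEdge k (g i) (g j) := by
  ext x
  cases x with
  | none => simp [apexEdge, blockMap]
  | some p =>
    obtain ⟨a, b⟩ := p
    simp only [apexEdge, blockMap, mem_map, Function.Embedding.optionMap_apply]
    constructor
    · rintro ⟨y, hy, hyx⟩
      cases y with
      | none => simp at hyx
      | some q =>
        simp at hy
        rw [← hyx]
        rcases hy with h | h <;> simp [h]
    · intro h
      simp at h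
      rcases h with rfl | rfl
      · exact ⟨some (i, b), by simp, by simp⟩
      · exact ⟨some (j, b), by simp, by simp⟩

section
variable {V : Type*} [DecidableEq V]

/-- The parity of the number of edges of `H` among the three edges of the copy of the suspended
triangle placed at `ψ`. -/
def triangleParity {k : ℕ} (H : Finset (Finset V)) (ψ : Option (Fin 3 × Fin k) ↪ V) : ZMod 2 :=
  let f : Finset V → ZMod 2 := fun e => if e ∈ H then 1 else 0
  f ((apexEdge k 0 1).map ψ) + f ((apexEdge k 1 2).map ψ) + f ((apexEdge k 2 0).map ψ)

/-- Disjoint `k`-sets `S 0`, `S 1`, `S 2` and a further vertex `v` form an embedded block system. -/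
theorem exists_blocks {W : Type*} [DecidableEq W] {k : ℕ} {v : W} {S : Fin 3 → Finset W}
    (hS : ∀ i, #(S i) = k) (hv : ∀ i, v ∉ S i) (hd : ∀ i j, i ≠ j → Disjoint (S i) (S j)) :
    ∃ ψ : Option (Fin 3 × Fin k) ↪ W,
      ∀ i j, (apexEdge k i j).map ψ = insert v (S i ∪ S j) := by
  let g : ∀ i, Fin k ≃ S i := fun i => ((S i).equivFinOfCardEq (hS i)).symm
  let F : Option (Fin 3 × Fin k) → W := fun o => o.elim v fun p => (g p.1 p.2 : W)
  have hF : Function.Injective F := by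
    rintro (_ | ⟨i, a⟩) (_ | ⟨j, b⟩) h
    · rfl
    · exact absurd ((g j b).2) (by rw [← show v = (g j b : W) from h]; exact hv j)
    · exact absurd ((g i a).2) (by rw [show (g i a : W) = v from h]; exact hv i)
    · have h' : (g i a : W) = g j b := h
      by_cases hij : i = j
      · subst hij
        rw [(g i).injective (Subtype.ext h')]
      · exact absurd (h' ▸ (g j b).2 : (g i a : W) ∈ S j) (disjoint_left.mp (hd i j hij) (g i a).2)
  refine ⟨⟨F, hF⟩, fun i j => ?_⟩
  ext w
  simp only [apexEdge, mem_map, Function.Embedding.coeFn_mk, mem_insert, mem_union]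
  constructor
  · rintro ⟨_ | ⟨l, a⟩, hl, rfl⟩
    · exact Or.inl rfl
    · simp at hl
      rcases hl with rfl | rfl
      · exact Or.inr (Or.inl (g l a).2)
      · exact Or.inr (Or.inr (g l a).2)
  · rintro (rfl | h | h)
    · exact ⟨none, by simp, rfl⟩
    · exact ⟨some (i, (g i).symm ⟨w, h⟩), by simp, by simp [F]⟩
    · exact ⟨some (j, (g j).symm ⟨w, h⟩), by simp, by simp [F]⟩

/-- Every edge of `H` inside a window `W` of at least `3 * k + 2` vertices forces an odd copy of the
suspended triangle inside `W`. -/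
theorem exists_triangleParity_ne_zero {W : Type*} [DecidableEq W] [Fintype W] {k : ℕ} (hk : 1 ≤ k)
    (hW : 3 * k + 2 ≤ Fintype.card W) {H : Finset (Finset V)} (ι : W ↪ V) {E : Finset W}
    (hE : #E = 2 * k + 1) (hEH : E.map ι ∈ H) :
    ∃ ψ : Option (Fin 3 × Fin k) ↪ W, triangleParity H (ψ.trans ι) ≠ 0 := by
  by_contra! hno
  have := eq_zero_of_triangle_relation hk hW
    (f := fun e => if e.map ι ∈ H then (1 : ZMod 2) else 0) ?_ hE
  · simp [hEH] at this
  · intro v S hS hv hd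
    obtain ⟨ψ, hψ⟩ := exists_blocks hS hv hd
    have := hno ψ
    simpa only [triangleParity, ← map_map, hψ] using this

end

/-! ### Averaging over permutations of the vertex set -/

section
variable {V : Type*} [DecidableEq V] [Fintype V]

/-- Under a random permutation, all embeddings of `α` are equally likely to acquire a property. -/
theorem card_filter_perm_eq {α : Type*} [Finite α] (P : (α ↪ V) → Prop) [DecidablePred P]
    (ψ ψ' : α ↪ V) :
    #{σ : Equiv.Perm V | P (ψ.trans σ.toEmbedding)} =
      #{σ : Equiv.Perm V | P (ψ'.trans σ.toEmbedding)} := by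
  obtain ⟨τ, hτ⟩ := Equiv.Perm.exists_extending_pair ψ' ψ ψ'.injective ψ.injective
  refine card_equiv (Equiv.mulRight τ) fun σ => ?_
  have : ψ'.trans (σ * τ).toEmbedding = ψ.trans σ.toEmbedding := by
    ext a
    simp [← hτ]
  simp [this]

/-- Under a random permutation, sets of equal size are equally likely to be mapped into `H`. -/
theorem card_filter_map_mem_eq (H : Finset (Finset V)) {E E' : Finset V} (h : #E = #E') :
    #{σ : Equiv.Perm V | E.map σ.toEmbedding ∈ H} =
      #{σ : Equiv.Perm V | E'.map σ.toEmbedding ∈ H} := by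
  obtain ⟨τ, rfl⟩ := Equiv.Perm.exists_map_finset_eq E' E h.symm
  refine card_equiv (Equiv.mulRight τ) fun σ => ?_
  have : (E'.map τ.toEmbedding).map σ.toEmbedding = E'.map (σ * τ).toEmbedding := by
    rw [map_map]; rfl
  simp [this]

/-- The probability that a random permutation maps a given `r`-set to an edge of the `r`-graph `H`
is the edge density of `H`. -/
theorem choose_mul_card_filter_perm {r : ℕ} {H : Finset (Finset V)}
    (hH : ∀ e ∈ H, #e = r) {E : Finset V} (hE : #E = r) :
    (Fintype.card V).choose r * #{σ : Equiv.Perm V | E.map σ.toEmbedding ∈ H} =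
      (Fintype.card V).factorial * #H := by
  have hconst : ∀ E' ∈ powersetCard r (univ : Finset V),
      #{σ : Equiv.Perm V | E'.map σ.toEmbedding ∈ H} =
        #{σ : Equiv.Perm V | E.map σ.toEmbedding ∈ H} := fun E' hE' =>
    card_filter_map_mem_eq H ((mem_powersetCard.mp hE').2.trans hE.symm)
  have hdc := sum_card_bipartiteAbove_eq_sum_card_bipartiteBelow
    (s := powersetCard r (univ : Finset V)) (t := (univ : Finset (Equiv.Perm V)))
    (fun E' σ => E'.map σ.toEmbedding ∈ H)
  simp only [bipartiteAbove, bipartiteBelow] at hdc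
  rw [sum_congr rfl hconst, sum_const, card_powersetCard, card_univ, smul_eq_mul] at hdc
  rw [hdc, ← Fintype.card_perm, ← card_univ, ← smul_eq_mul, ← sum_const]
  refine sum_congr rfl fun σ _ => ?_
  refine card_nbij' (fun D => D.map σ.toEmbedding) (fun D => D.map σ.symm.toEmbedding) ?_ ?_ ?_ ?_
  · intro D hD
    exact (mem_filter.mp hD).2
  · intro D hD
    have hmm : (D.map σ.symm.toEmbedding).map σ.toEmbedding = D := by ext; simp
    have hD' : D ∈ H := hD
    simp [hmm, hD', hH D hD']
  · intro D _; ext; simp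
  · intro D _; ext; simp

/-- The edge density of `H` is at most a constant, depending only on `k`, times the proportion of
odd copies of the suspended triangle: a union bound over the copies in a window of `3 * k + 2`
vertices. -/
theorem card_filter_mem_le {k : ℕ} (hk : 1 ≤ k) (H : Finset (Finset V))
    (hV : 3 * k + 2 ≤ Fintype.card V) (ψ : Option (Fin 3 × Fin k) ↪ V) {E : Finset V}
    (hE : #E = 2 * k + 1) :
    #{σ : Equiv.Perm V | E.map σ.toEmbedding ∈ H} ≤
      Fintype.card (Option (Fin 3 × Fin k) ↪ Fin (3 * k + 2)) *
        #{σ : Equiv.Perm V | triangleParity H (ψ.trans σ.toEmbedding) ≠ 0} := by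
  obtain ⟨ι⟩ : Nonempty (Fin (3 * k + 2) ↪ V) := by
    rw [Function.Embedding.nonempty_iff_card_le]; simpa
  obtain ⟨E₀, -, hE₀⟩ := exists_subset_card_eq (s := (univ : Finset (Fin (3 * k + 2))))
    (n := 2 * k + 1) (by simp; omega)
  have e1 := card_filter_map_mem_eq H (hE.trans ((card_map ι).trans hE₀).symm)
  have hsub : ({σ : Equiv.Perm V | (E₀.map ι).map σ.toEmbedding ∈ H} : Finset _) ⊆
      (univ : Finset (Option (Fin 3 × Fin k) ↪ Fin (3 * k + 2))).biUnion fun φ =>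
        {σ : Equiv.Perm V | triangleParity H ((φ.trans ι).trans σ.toEmbedding) ≠ 0} := by
    intro σ hσ
    rw [mem_filter, map_map] at hσ
    obtain ⟨φ, hφ⟩ := exists_triangleParity_ne_zero hk (by simp) _ hE₀ hσ.2
    exact mem_biUnion.mpr ⟨φ, mem_univ _, mem_filter.mpr ⟨mem_univ _, hφ⟩⟩
  rw [e1]
  refine (card_le_card hsub).trans ?_
  rw [← card_univ]
  refine card_biUnion_le_card_mul _ _ _ fun φ _ => ?_
  exact (card_filter_perm_eq (fun φ => triangleParity H φ ≠ 0) _ _).le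

end

/-! ### Odd triples in triangle-free graphs -/

/-- Goodman's bound. If `A` is the adjacency matrix of a triangle-free graph, then the summand is
the indicator of the triples `(i, j, l)` spanning an odd number of edges; if the density is close to
`1 / 2`, there are few of them. The inequality itself amounts to `∑ i, (d i - m / 2) ^ 2 ≥ 0` for
the row sums `d i`, which are the degrees. -/
theorem sum_oddTriple_le {m : ℕ} (A : Fin m → Fin m → ℝ) (hsymm : ∀ i j, A i j = A j i) :
    ∑ i, ∑ j, ∑ l, (A i j + A j l + A l i - 2 * (A i j * A j l + A j l * A l i + A l i * A i j)) ≤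
      3 / 2 * (m : ℝ) ^ 3 - 3 * m * ∑ i, ∑ j, A i j := by
  set d : Fin m → ℝ := fun i => ∑ j, A i j with hd
  have hd' : ∀ j, ∑ i, A i j = d j := fun j => sum_congr rfl fun i _ => hsymm i j
  have s1 : ∑ i, ∑ j, ∑ _l : Fin m, A i j = m * ∑ i, d i := by
    simp [hd, mul_sum]
  have s2 : ∑ _i : Fin m, ∑ j, ∑ l, A j l = m * ∑ i, d i := by
    simp [hd]
  have s3 : ∑ i, ∑ _j : Fin m, ∑ l, A l i = m * ∑ i, d i := by
    simp [hd', mul_sum]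
  have q1 : ∑ i, ∑ j, ∑ l, A i j * A j l = ∑ i, d i ^ 2 := by
    rw [sum_comm]
    refine sum_congr rfl fun j _ => ?_
    simp_rw [← mul_sum, ← sum_mul, hd', sq]; rfl
  have q2 : ∑ i, ∑ j, ∑ l, A j l * A l i = ∑ i, d i ^ 2 := by
    have : ∀ i, ∑ j, ∑ l, A j l * A l i = ∑ l, d l * A l i := by
      intro i
      rw [sum_comm]
      simp_rw [← sum_mul, hd']
    simp_rw [this]
    rw [sum_comm]
    refine sum_congr rfl fun j _ => ?_
    rw [← mul_sum, sq]
  have q3 : ∑ i, ∑ j, ∑ l, A l i * A i j = ∑ i, d i ^ 2 := by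
    refine sum_congr rfl fun i _ => ?_
    simp_rw [← sum_mul, hd', ← mul_sum, sq]; rfl
  have hsq : 0 ≤ ∑ i, (d i - m / 2) ^ 2 := sum_nonneg fun i _ => sq_nonneg _
  have hexp : ∑ i, (d i - m / 2) ^ 2 = ∑ i, d i ^ 2 - m * ∑ i, d i + (m : ℝ) ^ 3 / 4 := by
    simp_rw [sub_sq, sum_add_distrib, sum_sub_distrib]
    simp only [sum_const, card_univ, Fintype.card_fin, nsmul_eq_mul, mul_sum]
    congr 1
    · congr 1
      exact sum_congr rfl fun i _ => by ring
    · ring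
  simp_rw [sum_sub_distrib, ← mul_sum, sum_add_distrib, s1, s2, s3, q1, q2, q3]
  change _ ≤ _ - 3 * m * ∑ i, d i
  linarith

theorem sum_embedding_le_sum {m : ℕ} (F : Fin m → Fin m → Fin m → ℝ) (hF : ∀ i j l, 0 ≤ F i j l) :
    ∑ g : Fin 3 ↪ Fin m, F (g 0) (g 1) (g 2) ≤ ∑ i, ∑ j, ∑ l, F i j l := by
  have hinj : Function.Injective fun g : Fin 3 ↪ Fin m => (g 0, g 1, g 2) := by
    intro g g' h
    simp only [Prod.mk.injEq] at h
    ext i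
    fin_cases i <;> simp [h]
  simp_rw [← sum_product', univ_product_univ]
  refine (sum_map univ ⟨_, hinj⟩ fun p : Fin m × Fin m × Fin m => F p.1 p.2.1 p.2.2).ge.trans ?_
  exact sum_le_sum_of_subset_of_nonneg (subset_univ _) fun p _ _ => hF _ _ _

section
variable {V : Type*} [DecidableEq V]

/-- For a single apex and `m` blocks embedded by `b`, few triples of blocks span an odd copy of the
suspended triangle if many pairs of blocks span an edge. -/
theorem card_filter_triangleParity_le {k m : ℕ} {H : Finset (Finset V)}
    (hfree : ∀ ψ : Option (Fin 3 × Fin k) ↪ V, ¬ ((apexEdge k 0 1).map ψ ∈ H ∧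
      (apexEdge k 1 2).map ψ ∈ H ∧ (apexEdge k 2 0).map ψ ∈ H))
    (b : Option (Fin m × Fin k) ↪ V) :
    (#{g : Fin 3 ↪ Fin m | triangleParity H ((blockMap k g).trans b) ≠ 0} : ℝ) ≤
      3 / 2 * (m : ℝ) ^ 3 -
        3 * m * ∑ i, ∑ j, if i ≠ j ∧ (apexEdge k i j).map b ∈ H then 1 else 0 := by
  set A : Fin m → Fin m → ℝ :=
    fun i j => if i ≠ j ∧ (apexEdge k i j).map b ∈ H then 1 else 0 with hA
  have hsymm : ∀ i j, A i j = A j i := fun i j => by simp only [hA, apexEdge_comm k i j, ne_comm]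
  have h01 : ∀ i j, A i j = 0 ∨ A i j = 1 := fun i j => by simp only [hA]; split_ifs <;> simp
  have hmap : ∀ (g : Fin 3 ↪ Fin m) i j, i ≠ j →
      A (g i) (g j) = if (apexEdge k i j).map ((blockMap k g).trans b) ∈ H then 1 else 0 := by
    intro g i j hij
    simp only [hA, ← map_map, map_blockMap_apexEdge, ne_eq, g.injective.eq_iff, hij,
      not_false_eq_true, true_and]
  refine le_trans ?_ (sum_oddTriple_le A hsymm)
  refine le_trans ?_ (sum_embedding_le_sum _ ?_)
  · rw [card_filter, Nat.cast_sum]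
    refine sum_le_sum fun g _ => ?_
    have := hfree ((blockMap k g).trans b)
    rw [hmap g 0 1 (by decide), hmap g 1 2 (by decide), hmap g 2 0 (by decide), triangleParity]
    have h2 : (1 : ZMod 2) + 1 = 0 := rfl
    clear hmap hsymm h01 hfree
    split_ifs <;> simp_all <;> norm_num
  · intro i j l
    by_cases hall : A i j = 1 ∧ A j l = 1 ∧ A l i = 1
    · -- three pairwise adjacent blocks would span a copy of the forbidden configuration
      exfalso
      have hpos : ∀ {a c}, A a c = 1 → a ≠ c ∧ (apexEdge k a c).map b ∈ H := fun h => by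
        by_contra hno
        simp [hA, hno] at h
      obtain ⟨⟨hij, h1⟩, ⟨hjl, h2⟩, ⟨hli, h3⟩⟩ := And.imp hpos (And.imp hpos hpos) hall
      have hg : Function.Injective ![i, j, l] := by
        intro a c h
        fin_cases a <;> fin_cases c <;> first
          | rfl
          | exact absurd h hij
          | exact absurd h hij.symm
          | exact absurd h hjl
          | exact absurd h hjl.symm
          | exact absurd h hli
          | exact absurd h hli.symm
      refine hfree ((blockMap k ⟨_, hg⟩).trans b) ?_
      simp only [← map_map, map_blockMap_apexEdge]
      exact ⟨h1, h2, h3⟩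
    · rcases h01 i j with h1 | h1 <;> rcases h01 j l with h2 | h2 <;>
        rcases h01 l i with h3 | h3 <;> rw [h1, h2, h3] at hall ⊢ <;>
        first | exact absurd ⟨rfl, rfl, rfl⟩ hall | norm_num

variable [Fintype V]

/-- The average of `card_filter_triangleParity_le` over all permutations: odd copies are rare if `H`
is dense. -/
theorem mul_card_filter_triangleParity_le {k m : ℕ} {H : Finset (Finset V)}
    (hfree : ∀ ψ : Option (Fin 3 × Fin k) ↪ V, ¬ ((apexEdge k 0 1).map ψ ∈ H ∧
      (apexEdge k 1 2).map ψ ∈ H ∧ (apexEdge k 2 0).map ψ ∈ H))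
    (b : Option (Fin m × Fin k) ↪ V) (ψ : Option (Fin 3 × Fin k) ↪ V) {E : Finset V}
    (hE : #E = 2 * k + 1) :
    ((m * (m - 1) * (m - 2) : ℝ)) *
        #{σ : Equiv.Perm V | triangleParity H (ψ.trans σ.toEmbedding) ≠ 0} ≤
      3 / 2 * (m : ℝ) ^ 3 * (Fintype.card V).factorial -
        3 * m * (m * (m - 1) * #{σ : Equiv.Perm V | E.map σ.toEmbedding ∈ H}) := by
  have hsum := sum_le_sum fun (σ : Equiv.Perm V) (_ : σ ∈ univ) =>
    card_filter_triangleParity_le hfree (b.trans σ.toEmbedding)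
  have hL : ∑ σ : Equiv.Perm V, (#{g : Fin 3 ↪ Fin m |
      triangleParity H ((blockMap k g).trans (b.trans σ.toEmbedding)) ≠ 0} : ℝ) =
      (m * (m - 1) * (m - 2) : ℝ) *
        #{σ : Equiv.Perm V | triangleParity H (ψ.trans σ.toEmbedding) ≠ 0} := by
    have hdc := sum_card_bipartiteAbove_eq_sum_card_bipartiteBelow
      (s := (univ : Finset (Equiv.Perm V))) (t := (univ : Finset (Fin 3 ↪ Fin m)))
      (fun σ g => triangleParity H ((blockMap k g).trans (b.trans σ.toEmbedding)) ≠ 0)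
    simp only [bipartiteAbove, bipartiteBelow] at hdc
    have hconst : ∀ g : Fin 3 ↪ Fin m, #{σ : Equiv.Perm V |
        triangleParity H ((blockMap k g).trans (b.trans σ.toEmbedding)) ≠ 0} =
        #{σ : Equiv.Perm V | triangleParity H (ψ.trans σ.toEmbedding) ≠ 0} := fun g =>
      card_filter_perm_eq (fun φ => triangleParity H φ ≠ 0) ((blockMap k g).trans b) ψ
    rw [← Nat.cast_sum, hdc, sum_congr rfl fun g _ => hconst g, sum_const, card_univ,
      Fintype.card_embedding_eq, smul_eq_mul]
    push_cast
    congr 1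
    -- the truncated subtractions of `descFactorial` are harmless, since small `m` give `0`
    simp only [Fintype.card_fin]
    rcases m with _ | _ | m
    · simp
    · simp [Nat.descFactorial]
    · simp [Nat.descFactorial]; ring
  have hA : ∑ σ : Equiv.Perm V, ∑ i : Fin m, ∑ j : Fin m,
      (if i ≠ j ∧ (apexEdge k i j).map (b.trans σ.toEmbedding) ∈ H then (1 : ℝ) else 0) =
      m * (m - 1) * #{σ : Equiv.Perm V | E.map σ.toEmbedding ∈ H} := by
    have hone : ∀ i j : Fin m, ∑ σ : Equiv.Perm V,
        (if i ≠ j ∧ (apexEdge k i j).map (b.trans σ.toEmbedding) ∈ H then (1 : ℝ) else 0) =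
        if i ≠ j then (#{σ : Equiv.Perm V | E.map σ.toEmbedding ∈ H} : ℝ) else 0 := by
      intro i j
      by_cases hij : i = j
      · simp [hij]
      · rw [← card_filter_map_mem_eq H (E := (apexEdge k i j).map b)
          (((card_map b).trans (card_apexEdge k hij)).trans hE.symm), card_filter, Nat.cast_sum]
        simp [hij, map_map]
    have hrow : ∀ i : Fin m, ∑ σ : Equiv.Perm V, ∑ j : Fin m,
        (if i ≠ j ∧ (apexEdge k i j).map (b.trans σ.toEmbedding) ∈ H then (1 : ℝ) else 0) =
        (m - 1) * #{σ : Equiv.Perm V | E.map σ.toEmbedding ∈ H} := by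
      intro i
      rw [sum_comm, sum_congr rfl fun j _ => hone i j, ← sum_filter, sum_const, nsmul_eq_mul,
        filter_ne, card_erase_of_mem (mem_univ _), card_univ, Fintype.card_fin,
        Nat.cast_sub (by have := i.pos; omega), Nat.cast_one]
    rw [sum_comm, sum_congr rfl fun i _ => hrow i, sum_const, card_univ, Fintype.card_fin,
      nsmul_eq_mul, mul_assoc]
  rw [hL, sum_sub_distrib, ← mul_sum univ _ (3 * (m : ℝ)), hA, sum_const, card_univ,
    Fintype.card_perm, nsmul_eq_mul] at hsum
  linarith
end

/-! ### The density bound -/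

namespace UniformHypergraph

theorem suspension_expandedTriangle_isContained {V : Type*} {k : ℕ}
    {H : UniformHypergraph V (2 * k + 1)} (ψ : Option (Fin 3 × Fin k) ↪ V)
    (h01 : (apexEdge k 0 1).map ψ ∈ H.edges) (h12 : (apexEdge k 1 2).map ψ ∈ H.edges)
    (h20 : (apexEdge k 2 0).map ψ ∈ H.edges) :
    ((expandedTriangle k).suspension (2 * k + 1) (Nat.le_succ (2 * k))).IsContained H := by
  have hsub : Subsingleton (Fin (2 * k + 1 - 2 * k)) := by
    rw [show 2 * k + 1 - 2 * k = 1 by omega]; infer_instance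
  let c : (Fin 3 × Fin k) ⊕ Fin (2 * k + 1 - 2 * k) ↪ Option (Fin 3 × Fin k) :=
    ⟨Sum.elim some fun _ => none, by
      rintro (a | a) (b | b) h
      · simpa using h
      · simp at h
      · simp at h
      · rw [Subsingleton.elim a b]⟩
  have hc : ∀ i j : Fin 3, (Finset.disjSum ({i} ×ˢ univ ∪ {j} ×ˢ univ : Finset (Fin 3 × Fin k))
      (univ : Finset (Fin (2 * k + 1 - 2 * k)))).map c = apexEdge k i j := by
    intro i j
    have z : Fin (2 * k + 1 - 2 * k) := ⟨0, by omega⟩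
    ext x
    rcases x with _ | ⟨a, b⟩
    · simp only [mem_map, apexEdge, none_mem_insertNone, iff_true]
      exact ⟨Sum.inr z, by simp, rfl⟩
    · have hl : ∀ p, c (Sum.inl p) = some p := fun _ => rfl
      have hr : ∀ q, c (Sum.inr q) = none := fun _ => rfl
      simp [hl, hr, apexEdge, eq_comm]
  refine ⟨c.trans ψ, fun e he => ?_⟩
  obtain ⟨e', he', rfl⟩ := mem_map.mp he
  simp only [expandedTriangle, mem_insert, mem_singleton] at he'
  rw [← map_map]
  rcases he' with rfl | rfl | rfl
  · exact (hc 0 1).symm ▸ h01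
  · exact (hc 1 2).symm ▸ h12
  · exact (hc 2 0).symm ▸ h20

/-- For every `m ≥ 3`, an upper bound on the edge density of a hypergraph without the suspended
triangle that does not depend on the number of vertices. It combines `mul_card_filter_triangleParity_le` and
`card_filter_mem_le` and is below `1 / 2` as soon as `3 * C * m < (m - 1) * (m - 2)`. -/
theorem IsFree.card_edges_mul_le {k m n : ℕ} (hk : 1 ≤ k) (hm : 3 ≤ m)
    (hn : m * k + 2 ≤ n) {H : UniformHypergraph (Fin n) (2 * k + 1)}
    (hH : ((expandedTriangle k).suspension (2 * k + 1) (Nat.le_succ (2 * k))).IsFree H) {C : ℝ}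
    (hC : C = Fintype.card (Option (Fin 3 × Fin k) ↪ Fin (3 * k + 2))) :
    (H.edges.card : ℝ) * ((m - 1) * (m - 2) + 3 * C * m * (m - 1)) ≤
      3 / 2 * C * m ^ 2 * n.choose (2 * k + 1) := by
  have hmk : 3 * k ≤ m * k := Nat.mul_le_mul_right _ hm
  have hfree : ∀ ψ : Option (Fin 3 × Fin k) ↪ Fin n, ¬ ((apexEdge k 0 1).map ψ ∈ H.edges ∧
      (apexEdge k 1 2).map ψ ∈ H.edges ∧ (apexEdge k 2 0).map ψ ∈ H.edges) :=
    fun ψ h => hH (suspension_expandedTriangle_isContained ψ h.1 h.2.1 h.2.2)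
  obtain ⟨b⟩ : Nonempty (Option (Fin m × Fin k) ↪ Fin n) := by
    rw [Function.Embedding.nonempty_iff_card_le]; simp; omega
  obtain ⟨ψ⟩ : Nonempty (Option (Fin 3 × Fin k) ↪ Fin n) := by
    rw [Function.Embedding.nonempty_iff_card_le]; simp; omega
  obtain ⟨E, -, hE⟩ := exists_subset_card_eq (s := (univ : Finset (Fin n)))
    (n := 2 * k + 1) (by simp; omega)
  have h1 := mul_card_filter_triangleParity_le hfree b ψ hE
  have h2 := card_filter_mem_le hk H.edges (by simp; omega) ψ hE
  have h3 := choose_mul_card_filter_perm (fun e he => H.sized he) hE (H := H.edges)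
  rw [← @Nat.cast_le ℝ, Nat.cast_mul, ← hC] at h2
  rw [← @Nat.cast_inj ℝ] at h3
  simp only [Fintype.card_fin, Nat.cast_mul] at h1 h3
  set p : ℝ := (#{σ : Equiv.Perm (Fin n) | E.map σ.toEmbedding ∈ H.edges} : ℝ)
  set B : ℝ := (#{σ : Equiv.Perm (Fin n) |
    triangleParity H.edges (ψ.trans σ.toEmbedding) ≠ 0} : ℝ)
  set N : ℝ := (n.factorial : ℝ)
  have hN : 0 < N := Nat.cast_pos.mpr n.factorial_pos
  have hm' : (3 : ℝ) ≤ m := by exact_mod_cast hm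
  have hm0 : (0 : ℝ) < m := by linarith
  have hC0 : 0 ≤ C := hC ▸ Nat.cast_nonneg _
  -- `p ≤ C * B` bounds the density by the number of odd copies, and `h1'` bounds the latter by
  -- a decreasing function of the density
  have h1' : (m - 1) * (m - 2) * B ≤ 3 / 2 * (m : ℝ) ^ 2 * N - 3 * (m * (m - 1) * p) :=
    le_of_mul_le_mul_left (by linarith) hm0
  have h4 : (m - 1 : ℝ) * (m - 2) * p ≤ C * (3 / 2 * (m : ℝ) ^ 2 * N - 3 * (m * (m - 1) * p)) :=
    calc (m - 1 : ℝ) * (m - 2) * p ≤ (m - 1) * (m - 2) * (C * B) :=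
          mul_le_mul_of_nonneg_left h2 (mul_nonneg (by linarith) (by linarith))
      _ = C * ((m - 1) * (m - 2) * B) := by ring
      _ ≤ _ := mul_le_mul_of_nonneg_left h1' hC0
  have h5 : p * ((m - 1) * (m - 2) + 3 * C * m * (m - 1)) ≤ 3 / 2 * C * m ^ 2 * N := by linarith
  have h6 := mul_le_mul_of_nonneg_left h5 (Nat.cast_nonneg (α := ℝ) (n.choose (2 * k + 1)))
  refine le_of_mul_le_mul_left ?_ hN
  rw [← mul_assoc, ← mul_assoc, h3] at h6
  linarith

end UniformHypergraph

theorem mainTheorem2 (k : ℕ) (hk : 1 ≤ k) :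
    UniformHypergraph.turanDensity
      ((UniformHypergraph.expandedTriangle k).suspension (2 * k + 1) (Nat.le_succ (2 * k)))
      < 1 / 2 := by
  set F := (UniformHypergraph.expandedTriangle k).suspension (2 * k + 1) (Nat.le_succ (2 * k))
  obtain ⟨c, hc⟩ : ∃ c, c = Fintype.card (Option (Fin 3 × Fin k) ↪ Fin (3 * k + 2)) := ⟨_, rfl⟩
  obtain ⟨C, hC⟩ : ∃ C : ℝ, C = c := ⟨_, rfl⟩
  have hC0 : 0 ≤ C := hC ▸ Nat.cast_nonneg _
  -- `3 * C * m < (m - 1) * (m - 2)` holds for `m = 3 * C + 3`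
  obtain ⟨m, hm⟩ : ∃ m, m = 3 * c + 3 := ⟨_, rfl⟩
  have hmC : (m : ℝ) = 3 * C + 3 := by rw [hm, hC]; push_cast; ring
  set D : ℝ := (m - 1) * (m - 2) + 3 * C * m * (m - 1) with hD
  have hlt : 3 * C * m ^ 2 < D := by
    rw [hD, hmC]; nlinarith
  have hDpos : 0 < D := lt_of_le_of_lt (by positivity) hlt
  have hev : ∀ᶠ n : ℕ in Filter.atTop,
      (UniformHypergraph.turanNumber n F : ℝ) / (n.choose (2 * k + 1) : ℝ) ≤
        3 / 2 * C * m ^ 2 / D := by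
    filter_upwards [Filter.eventually_ge_atTop (m * k + 2 + (2 * k + 1))] with n hn
    have hch : (0 : ℝ) < n.choose (2 * k + 1) := by exact_mod_cast Nat.choose_pos (by omega)
    rw [div_le_div_iff₀ hch hDpos]
    by_cases hne : (UniformHypergraph.freeSizes n F).Nonempty
    · obtain ⟨H, hH, hcard⟩ := Nat.sSup_mem hne (UniformHypergraph.bddAbove_freeSizes n F)
      have := hH.card_edges_mul_le hk (by omega : 3 ≤ m) (by omega) (hc ▸ hC)
      rwa [hcard] at this
    · rw [Set.not_nonempty_iff_eq_empty] at hne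
      simp only [UniformHypergraph.turanNumber, hne, csSup_empty, bot_eq_zero, Nat.cast_zero,
        zero_mul]
      positivity
  refine lt_of_le_of_lt (le_of_tendsto (UniformHypergraph.tendsto_turanDensity F) hev) ?_
  rw [div_lt_iff₀ hDpos]
  linarith
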